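/- Consider problems indexed by $r=1,2,\dots$. In the $r$-th problem there are $\mathcal C_r\ge 1$ possible messages, a set $\Lambda_r\subseteq\{1,\dots,\mathcal C_r\}$ of $K_r$ transmitted messages with $0/1$ indicator vector $s\in\{0,1\}^{\mathcal C_r}$, a code length $n_r$ and a power $Q_r>0$ (for instance a constant $Q_r=Q$). The measurements are $y=Xs+z$, where $X\in\mathbb R^{n_r\times\mathcal C_r}$ has i.i.d. $N(0,Q_r)$ entries (variance $Q_r$) and $z\sim N(0,I_{n_r})$ is independent of $X$; the correlations are $g=X^{T}y$. For a threshold $\lambda\in\mathbb R$ let $P_\lambda$ (resp. $Q_\lambda$) be the number of $i\in\Lambda_r$ (resp. $i\notin\Lambda_r$) with $g_i/(n_rQ_r)>\lambda$, divided by $\mathcal C_r$. Suppose that, as $r\to\infty$, $$n_r\to\infty,\qquad \frac{K_r}{\mathcal C_r}\to\delta,\qquad \frac{K_r+1/Q_r}{n_r}\to\rho\in(0,\infty).$$ Let $\Phi$ be the distribution function of the standard normal distribution. (1) For every $\lambda\in\mathbb R$, $$\mathbb E P_\lambda\to\delta\left[1-\Phi\left(\frac{\lambda-1}{\sqrt\rho}\right)\right],\qquad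 \mathbb E Q_\lambda\to(1-\delta)\left[1-\Phi\left(\frac{\lambda}{\sqrt\rho}\right)\right].$$ (2) (Phase transition of One Step Thresholding.) There is a function $c(\delta,\varepsilon)>0$ of $\delta>0$ and $\varepsilon>0$ with $\delta+\varepsilon<1$, depending on nothing else, such that for every sequence of problems as above with limits $\delta$ and $\rho$ the following hold. There is a $\lambda$ with $$\lim_{r\to\infty}\mathbb E P_\lambda=(1-\varepsilon)\delta,\qquad \lim_{r\to\infty}\mathbb E(P_\lambda+Q_\lambda)=\delta$$ if and only if $(K_r+1/Q_r)/n_r\to c(\delta,\varepsilon)$. Moreover there is exactly one $\lambda$ with $\lim_r\mathbb E(P_\lambda+Q_\lambda)=\delta$, and for this $\lambda$ one has $\lim_r\mathbb E P_\lambda=(1-p)\delta$, where the limiting fraction $p$ of transmitted messages that are missed satisfies $p<\varepsilon$, $p=\varepsilon$ or $p>\varepsilon$ according as $\rho<c(\delta,\varepsilon)$, $\rho=c(\delta,\varepsilon)$ or $\rho>c(\delta,\varepsilon)$. -/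

import Mathlib

open MeasureTheory ProbabilityTheory Filter Topology
open scoped NNReal Matrix

namespace OST

noncomputable section

/-- Outcomes: the entries of the `n × C` codebook matrix `X`, and the noise vector `z ∈ ℝⁿ`. -/
abbrev Outcome (n C : ℕ) : Type := (Fin n → Fin C → ℝ) × (Fin n → ℝ)

/-- The joint law of `(X, z)`: the entries of `X` are i.i.d. `N(0, Q)` (variance `Q`), the entries
of `z` are i.i.d. `N(0, 1)`, and `X` and `z` are independent. -/
def channelLaw (n C : ℕ) (Q : ℝ≥0) : Measure (Outcome n C) :=
  (Measure.pi fun _ : Fin n => Measure.pi fun _ : Fin C => gaussianReal 0 Q).prod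
    (Measure.pi fun _ : Fin n => gaussianReal 0 1)

variable {n C : ℕ}

/-- The codebook matrix `X`; its columns are the codewords. -/
def codebook (ω : Outcome n C) : Matrix (Fin n) (Fin C) ℝ := Matrix.of ω.1

/-- The noise `z`. -/
def noise (ω : Outcome n C) : Fin n → ℝ := ω.2

/-- The activity pattern `s ∈ {0,1}^C` of a set `Λ` of transmitted messages. -/
def activity (Λ : Finset (Fin C)) : Fin C → ℝ := fun i => if i ∈ Λ then 1 else 0

/-- The measurements `y = X s + z`. -/
def received (Λ : Finset (Fin C)) (ω : Outcome n C) : Fin n → ℝ :=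
  codebook ω *ᵥ activity Λ + noise ω

/-- The vector of correlations `g = Xᵀ y`. -/
def correlation (Λ : Finset (Fin C)) (ω : Outcome n C) : Fin C → ℝ :=
  (codebook ω)ᵀ *ᵥ received Λ ω

/-- `P_t`: the number of transmitted messages `i ∈ Λ` whose normalized correlation `g_i / (n Q)`
is above the threshold `t`, divided by `C`. -/
def fracTransmitted (Q : ℝ≥0) (Λ : Finset (Fin C)) (t : ℝ) (ω : Outcome n C) : ℝ :=
  ((Λ.filter fun i => t < correlation Λ ω i / (n * Q)).card : ℝ) / C

/-- `Q_t`: the number of non-transmitted messages `i ∉ Λ` whose normalized correlation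
`g_i / (n Q)` is above the threshold `t`, divided by `C`. -/
def fracNontransmitted (Q : ℝ≥0) (Λ : Finset (Fin C)) (t : ℝ) (ω : Outcome n C) : ℝ :=
  ((Λᶜ.filter fun i => t < correlation Λ ω i / (n * Q)).card : ℝ) / C

/-- The distribution function of the standard normal distribution. -/
def Phi (x : ℝ) : ℝ := cdf (gaussianReal 0 1) x

/-- A sequence of problems: in the `r`-th one there are `C r` possible messages, the set of
transmitted messages is `Λ r` (so `K r` is its cardinality), the code length is `n r` and the power
is `Q r`. The problem size grows with `K / C → δ` and `(K + 1 / Q) / n → ρ`. -/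
structure IsRegime (n C : ℕ → ℕ) (Q : ℕ → ℝ≥0) (Λ : ∀ r, Finset (Fin (C r))) (δ ρ : ℝ) :
    Prop where
  messages_pos : ∀ r, 0 < C r
  power_pos : ∀ r, 0 < Q r
  length_tendsto : Tendsto n atTop atTop
  density_tendsto : Tendsto (fun r => ((Λ r).card : ℝ) / C r) atTop (𝓝 δ)
  load_tendsto : Tendsto (fun r => (((Λ r).card : ℝ) + 1 / (Q r : ℝ)) / n r) atTop (𝓝 ρ)

end

end OST

namespace OST

noncomputable section

/-- The law of a pair of independent standard normal variables. -/
def stdPair : Measure (ℝ × ℝ) := (gaussianReal 0 1).prod (gaussianReal 0 1)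

instance : IsProbabilityMeasure stdPair := by unfold stdPair; infer_instance

lemma map_pi_gaussian_finset_sum {C : ℕ} (Q : ℝ≥0) (S : Finset (Fin C)) :
    (Measure.pi fun _ : Fin C => gaussianReal 0 Q).map (fun x => ∑ j ∈ S, x j) =
      gaussianReal 0 (S.card * Q) := by
  have hind : iIndepFun (fun (j : Fin C) (x : Fin C → ℝ) => x j)
      (Measure.pi fun _ : Fin C => gaussianReal 0 Q) :=
    iIndepFun_pi (X := fun _ => id) (fun _ => aemeasurable_id)
  induction S using Finset.induction_on with
  | empty =>
    simp [Measure.map_const]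
  | insert a S ha ih =>
    have h := hind.indepFun_finsetSum_of_notMem (fun j => measurable_pi_apply j) ha
    have h2 := gaussianReal_add_gaussianReal_of_indepFun h.symm
      (m₁ := 0) (v₁ := Q) (m₂ := 0) (v₂ := S.card * Q)
      ((measurePreserving_eval (fun _ : Fin C => gaussianReal 0 Q) a).map_eq)
      (by rw [← ih]; congr 1; ext x; simp)
    have e : (fun x : Fin C → ℝ => ∑ j ∈ insert a S, x j) =
        (fun x : Fin C → ℝ => x a) + ∑ j ∈ S, fun x : Fin C → ℝ => x j := by
      ext x; simp [Finset.sum_insert ha]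
    rw [e, h2, Finset.card_insert_of_notMem ha]
    congr 1
    · simp
    · push_cast; ring

lemma map_row_eq_prod {C : ℕ} (Q : ℝ≥0) (S : Finset (Fin C)) {i : Fin C} (hi : i ∉ S) :
    ((Measure.pi fun _ : Fin C => gaussianReal 0 Q).prod (gaussianReal 0 1)).map
        (fun p => (p.1 i, ∑ j ∈ S, p.1 j + p.2)) =
      (gaussianReal 0 Q).prod (gaussianReal 0 (S.card * Q + 1)) := by
  have hind : iIndepFun (fun (j : Fin C) (x : Fin C → ℝ) => x j)
      (Measure.pi fun _ : Fin C => gaussianReal 0 Q) :=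
    iIndepFun_pi (X := fun _ => id) (fun _ => aemeasurable_id)
  have h := (hind.indepFun_finsetSum_of_notMem (fun j => measurable_pi_apply j) hi).symm
  have e : (∑ j ∈ S, fun x : Fin C → ℝ => x j) = fun x => ∑ j ∈ S, x j := by ext x; simp
  rw [e, indepFun_iff_map_prod_eq_prod_map_map (measurable_pi_apply i).aemeasurable
      (by fun_prop),
    map_pi_gaussian_finset_sum,
    (measurePreserving_eval (fun _ : Fin C => gaussianReal 0 Q) i).map_eq] at h
  have e2 : (fun p : (Fin C → ℝ) × ℝ => (p.1 i, ∑ j ∈ S, p.1 j + p.2)) =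
      (Prod.map id fun q : ℝ × ℝ => q.1 + q.2) ∘ MeasurableEquiv.prodAssoc ∘
        Prod.map (fun x : Fin C → ℝ => (x i, ∑ j ∈ S, x j)) id := by
    rfl
  rw [e2, ← Measure.map_map (by fun_prop) (by fun_prop),
    ← Measure.map_map (by fun_prop) (by fun_prop),
    ← Measure.map_prod_map _ _ (by fun_prop) (by fun_prop), h, Measure.map_id,
    (measurePreserving_prodAssoc _ _ _).map_eq,
    ← Measure.map_prod_map _ _ (by fun_prop) (by fun_prop), Measure.map_id]
  congr 1
  have := gaussianReal_conv_gaussianReal (m₁ := 0) (m₂ := 0) (v₁ := S.card * Q) (v₂ := 1)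
  rw [Measure.conv] at this
  rw [this, add_zero]

lemma map_gaussianReal_div_sqrt {v : ℝ≥0} (hv : 0 < v) :
    (gaussianReal 0 v).map (· / √(v : ℝ)) = gaussianReal 0 1 := by
  rw [gaussianReal_map_div_const]
  congr 1
  · simp
  · ext
    simp [Real.sq_sqrt, hv.ne']

lemma map_row_eq_stdPair {C : ℕ} {Q : ℝ≥0} (hQ : 0 < Q) (S : Finset (Fin C)) {i : Fin C}
    (hi : i ∉ S) :
    ((Measure.pi fun _ : Fin C => gaussianReal 0 Q).prod (gaussianReal 0 1)).map
        (fun p => (p.1 i / √(Q : ℝ), (∑ j ∈ S, p.1 j + p.2) / √((S.card * Q + 1 : ℝ≥0) : ℝ))) =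
      stdPair := by
  have e : (fun p : (Fin C → ℝ) × ℝ =>
      (p.1 i / √(Q : ℝ), (∑ j ∈ S, p.1 j + p.2) / √((S.card * Q + 1 : ℝ≥0) : ℝ))) =
      (Prod.map (· / √(Q : ℝ)) (· / √((S.card * Q + 1 : ℝ≥0) : ℝ))) ∘
        (fun p => (p.1 i, ∑ j ∈ S, p.1 j + p.2)) := by
    ext p <;> simp
  rw [e, ← Measure.map_map (by fun_prop) (by fun_prop), map_row_eq_prod Q S hi,
    ← Measure.map_prod_map _ _ (by fun_prop) (by fun_prop), map_gaussianReal_div_sqrt hQ,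
    map_gaussianReal_div_sqrt (by positivity), stdPair]

lemma map_channelLaw_eq_pi_stdPair (n : ℕ) {C : ℕ} {Q : ℝ≥0} (hQ : 0 < Q) (S : Finset (Fin C))
    {i : Fin C} (hi : i ∉ S) :
    (channelLaw n C Q).map (fun ω k => (ω.1 k i / √(Q : ℝ),
        (∑ j ∈ S, ω.1 k j + ω.2 k) / √((S.card * Q + 1 : ℝ≥0) : ℝ))) =
      Measure.pi fun _ : Fin n => stdPair := by
  have h := measurePreserving_arrowProdEquivProdArrow (Fin C → ℝ) ℝ (Fin n)
    (fun _ => Measure.pi fun _ : Fin C => gaussianReal 0 Q) (fun _ => gaussianReal 0 1)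
  rw [channelLaw, ← h.map_eq, Measure.map_map (by fun_prop) (by fun_prop)]
  have hprob : IsProbabilityMeasure (((Measure.pi fun _ : Fin C => gaussianReal 0 Q).prod
      (gaussianReal 0 1)).map (fun p => (p.1 i / √(Q : ℝ),
        (∑ j ∈ S, p.1 j + p.2) / √((S.card * Q + 1 : ℝ≥0) : ℝ)))) := by
    rw [map_row_eq_stdPair hQ S hi]; infer_instance
  have h2 := Measure.pi_map_pi (μ := fun _ : Fin n =>
      (Measure.pi fun _ : Fin C => gaussianReal 0 Q).prod (gaussianReal 0 1))
    (f := fun _ p => (p.1 i / √(Q : ℝ),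
        (∑ j ∈ S, p.1 j + p.2) / √((S.card * Q + 1 : ℝ≥0) : ℝ)))
    (fun _ => by fun_prop)
  rw [map_row_eq_stdPair hQ S hi] at h2
  exact h2

/-- The law of an infinite sequence of independent standard normal pairs. -/
def pairSeq : Measure (ℕ → ℝ × ℝ) := Measure.infinitePi fun _ => stdPair

instance : IsProbabilityMeasure pairSeq := by unfold pairSeq; infer_instance

lemma map_pairSeq_eq_pi_stdPair (n : ℕ) :
    pairSeq.map (fun w (k : Fin n) => w k) = Measure.pi fun _ : Fin n => stdPair := by
  rw [pairSeq, Measure.map_infinitePi_infinitePi_of_inj (f := fun k : Fin n => (k : ℕ))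
    Fin.val_injective, Measure.infinitePi_eq_pi]

/-- The normalized correlation of a codeword with itself plus independent interference, in terms of
standard normal pairs; `a = 1` for a transmitted codeword and `a = 0` otherwise. -/
def pairStat (a b : ℝ) (n : ℕ) (w : ℕ → ℝ × ℝ) : ℝ :=
  b * ((√n)⁻¹ * ∑ k ∈ Finset.range n, (w k).1 * (w k).2) +
    a * ((∑ k ∈ Finset.range n, (w k).1 ^ 2) / n)

lemma channelLaw_real_lt_eq (n : ℕ) {C : ℕ} {Q : ℝ≥0} (hQ : 0 < Q) (S : Finset (Fin C))
    {i : Fin C} (hi : i ∉ S) (a t : ℝ) :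
    (channelLaw n C Q).real {ω | t <
        (∑ k, ω.1 k i * (a * ω.1 k i + (∑ j ∈ S, ω.1 k j + ω.2 k))) / (n * Q)} =
      pairSeq.real {w | t < pairStat a √((S.card + 1 / (Q : ℝ)) / n) n w} := by
  set A : Set (Fin n → ℝ × ℝ) := {v | t <
    √((S.card + 1 / (Q : ℝ)) / n) * ((√n)⁻¹ * ∑ k, (v k).1 * (v k).2) +
      a * ((∑ k, (v k).1 ^ 2) / n)} with hA
  have hAm : MeasurableSet A := measurableSet_lt (by fun_prop) (by fun_prop)
  have h1 := congrArg (fun m => m.real A) (map_channelLaw_eq_pi_stdPair n hQ S hi)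
  have h2 := congrArg (fun m => m.real A) (map_pairSeq_eq_pi_stdPair n)
  rw [map_measureReal_apply (by fun_prop) hAm] at h1 h2
  have hQ' : (0 : ℝ) < Q := hQ
  convert h1.trans h2.symm using 2
  · ext ω
    simp only [hA, Set.preimage_ofPred_eq, Set.mem_ofPred_eq]
    rcases Nat.eq_zero_or_pos n with rfl | hn
    · simp
    have hn' : (0 : ℝ) < n := by exact_mod_cast hn
    have e : √((S.card + 1 / (Q : ℝ)) / n) =
        √((S.card * Q + 1 : ℝ≥0) : ℝ) / (√(Q : ℝ) * √n) := by
      rw [← Real.sqrt_mul hQ'.le, ← Real.sqrt_div (by positivity)]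
      congr 1
      push_cast
      field_simp
    have hs1 : √((S.card * Q + 1 : ℝ≥0) : ℝ) ≠ 0 := by positivity
    have hs2 : √(Q : ℝ) ^ 2 = Q := Real.sq_sqrt hQ'.le
    have hs3 : √(n : ℝ) ^ 2 = n := Real.sq_sqrt hn'.le
    have hs4 : √(Q : ℝ) ≠ 0 := by positivity
    have hs5 : √(n : ℝ) ≠ 0 := by positivity
    refine Iff.of_eq (congrArg _ ?_)
    rw [e]
    generalize √((S.card * Q + 1 : ℝ≥0) : ℝ) = σ at *
    simp only [Finset.mul_sum, Finset.sum_div, ← Finset.sum_add_distrib]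
    refine Finset.sum_congr rfl fun k _ => ?_
    generalize ∑ j ∈ S, ω.1 k j + ω.2 k = y
    field_simp
    simp only [hs2, hs3]
    ring
  · ext w
    simp only [hA, Set.preimage_ofPred_eq, Set.mem_ofPred_eq, pairStat]
    rw [Fin.sum_univ_eq_sum_range (fun k => (w k).1 * (w k).2),
      Fin.sum_univ_eq_sum_range (fun k => (w k).1 ^ 2)]

instance : NullSingletonClass (gaussianReal 0 1) := nullSingletonClass_gaussianReal one_ne_zero

lemma integral_sq_stdGaussian : ∫ x, x ^ 2 ∂(gaussianReal 0 1) = 1 := by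
  have h := variance_fun_id_gaussianReal (μ := 0) (v := 1)
  rw [variance_eq_integral measurable_id'.aemeasurable] at h
  simpa [integral_id_gaussianReal] using h

lemma integrable_sq_stdGaussian : Integrable (fun x : ℝ => x ^ 2) (gaussianReal 0 1) :=
  (memLp_id_gaussianReal (μ := 0) (v := 1) 2).integrable_sq

lemma measurePreserving_eval_pairSeq (k : ℕ) :
    MeasurePreserving (fun w : ℕ → ℝ × ℝ => w k) pairSeq stdPair :=
  ⟨measurable_pi_apply k, by simp [pairSeq, Measure.infinitePi_map_eval]⟩

lemma identDistrib_pairSeq {f : ℝ × ℝ → ℝ} (hf : Measurable f) (k : ℕ) :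
    IdentDistrib (fun w : ℕ → ℝ × ℝ => f (w k)) (fun w => f (w 0)) pairSeq pairSeq := by
  refine IdentDistrib.comp (f := fun w : ℕ → ℝ × ℝ => w k) (g := fun w : ℕ → ℝ × ℝ => w 0)
    ⟨(measurable_pi_apply k).aemeasurable, (measurable_pi_apply 0).aemeasurable, ?_⟩ hf
  rw [(measurePreserving_eval_pairSeq k).map_eq, (measurePreserving_eval_pairSeq 0).map_eq]

lemma iIndepFun_pairSeq {f : ℝ × ℝ → ℝ} (hf : Measurable f) :
    iIndepFun (fun (k : ℕ) (w : ℕ → ℝ × ℝ) => f (w k)) pairSeq :=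
  iIndepFun_infinitePi (X := fun _ => f) fun _ => hf

lemma integral_eval_pairSeq {f : ℝ × ℝ → ℝ} (hf : Measurable f) (k : ℕ) :
    ∫ w, f (w k) ∂pairSeq = ∫ p, f p ∂stdPair := by
  rw [← (measurePreserving_eval_pairSeq k).map_eq,
    integral_map (measurable_pi_apply k).aemeasurable hf.aestronglyMeasurable]

lemma tendstoInDistribution_sum_mul :
    TendstoInDistribution
      (fun (n : ℕ) (w : ℕ → ℝ × ℝ) => (√n)⁻¹ * ∑ k ∈ Finset.range n, (w k).1 * (w k).2)
      atTop (id : ℝ → ℝ) (fun _ => pairSeq) (gaussianReal 0 1) := by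
  have hm : Measurable fun p : ℝ × ℝ => p.1 * p.2 := by fun_prop
  refine tendstoInDistribution_inv_sqrt_mul_sum
    (X := fun k (w : ℕ → ℝ × ℝ) => (w k).1 * (w k).2)
    ⟨aemeasurable_id, Measure.map_id⟩ ?_ ?_ (iIndepFun_pairSeq hm) (identDistrib_pairSeq hm)
  · rw [integral_eval_pairSeq hm, stdPair, integral_prod_mul (fun x : ℝ => x) (fun x : ℝ => x),
      integral_id_gaussianReal, zero_mul]
  · simp only [Pi.pow_apply]
    rw [integral_eval_pairSeq (hm.pow_const 2)]
    simp only [mul_pow]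
    rw [stdPair, integral_prod_mul (fun x : ℝ => x ^ 2) (fun x : ℝ => x ^ 2),
      integral_sq_stdGaussian, one_mul]

lemma ae_tendsto_average_sq :
    ∀ᵐ w ∂pairSeq,
      Tendsto (fun n : ℕ => (∑ k ∈ Finset.range n, (w k).1 ^ 2) / (n : ℝ)) atTop (𝓝 1) := by
  have hm : Measurable fun p : ℝ × ℝ => p.1 ^ 2 := by fun_prop
  have hint : Integrable (fun p : ℝ × ℝ => p.1 ^ 2) stdPair :=
    integrable_sq_stdGaussian.comp_fst _
  have h := strong_law_ae_real (μ := pairSeq) (fun k w => (w k).1 ^ 2)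
    ((measurePreserving_eval_pairSeq 0).integrable_comp_of_integrable hint)
    (fun i j hij => (iIndepFun_pairSeq hm).indepFun hij) (identDistrib_pairSeq hm)
  have e : ∫ w, (w 0).1 ^ 2 ∂pairSeq = 1 := by
    rw [integral_eval_pairSeq hm, stdPair, integral_fun_fst (fun x : ℝ => x ^ 2),
      integral_sq_stdGaussian]
    simp
  rwa [e] at h

lemma one_sub_Phi (x : ℝ) : 1 - Phi x = (gaussianReal 0 1).real (Set.Ioi x) := by
  rw [Phi, cdf_eq_real, ← Set.compl_Iic, probReal_compl_eq_one_sub measurableSet_Iic]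

/-- The upper tail of `pairStat` converges to that of the normal law with mean `a` and
standard deviation `β`. -/
lemma tendsto_pairSeq_real_lt_pairStat {n : ℕ → ℕ} (hn : Tendsto n atTop atTop) {b : ℕ → ℝ}
    {β : ℝ} (hβ : 0 < β) (hb : Tendsto b atTop (𝓝 β)) (a t : ℝ) :
    Tendsto (fun r => pairSeq.real {w | t < pairStat a (b r) (n r) w}) atTop
      (𝓝 (1 - Phi ((t - a) / β))) := by
  have hX : TendstoInDistribution
      (fun (r : ℕ) (w : ℕ → ℝ × ℝ) =>
        (√(n r))⁻¹ * ∑ k ∈ Finset.range (n r), (w k).1 * (w k).2)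
      atTop (id : ℝ → ℝ) (fun _ => pairSeq) (gaussianReal 0 1) :=
    ⟨fun r => tendstoInDistribution_sum_mul.forall_aemeasurable (n r), aemeasurable_id,
      tendstoInDistribution_sum_mul.tendsto.comp hn⟩
  have hYm : ∀ r, Measurable fun w : ℕ → ℝ × ℝ =>
      (b r, (∑ k ∈ Finset.range (n r), (w k).1 ^ 2) / (n r : ℝ)) := fun r => by fun_prop
  have hY : TendstoInMeasure pairSeq (fun (r : ℕ) (w : ℕ → ℝ × ℝ) =>
      (b r, (∑ k ∈ Finset.range (n r), (w k).1 ^ 2) / (n r : ℝ))) atTop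
      (fun _ => (β, (1 : ℝ))) := by
    refine tendstoInMeasure_of_tendsto_ae (fun r => (hYm r).aestronglyMeasurable) ?_
    filter_upwards [ae_tendsto_average_sq] with w hw
    exact hb.prodMk_nhds (hw.comp hn)
  have hg : Continuous fun q : ℝ × (ℝ × ℝ) => q.2.1 * q.1 + a * q.2.2 := by fun_prop
  have h := hX.continuous_comp_prodMk_of_tendstoInMeasure_const hg hY
    (fun r => (hYm r).aemeasurable)
  have hpre : ∀ x : ℝ, β * x + a * 1 = t ↔ x = (t - a) / β := fun x => by
    rw [eq_div_iff hβ.ne']; constructor <;> intro h <;> linarith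
  have hlim := ProbabilityMeasure.tendsto_measure_of_null_frontier_of_tendsto' h.tendsto
    (E := Set.Ioi t) (by
      simp only [ProbabilityMeasure.coe_mk, frontier_Ioi]
      rw [Measure.map_apply (by fun_prop) (measurableSet_singleton t)]
      have : (fun x : ℝ => β * id x + a * 1) ⁻¹' {t} = {(t - a) / β} := by
        ext x; simpa using hpre x
      rw [this, measure_singleton])
  have hlim' := (ENNReal.tendsto_toReal (by
    simp only [ProbabilityMeasure.coe_mk]; exact measure_ne_top _ _)).comp hlim
  convert hlim' using 1
  · ext r
    simp only [Function.comp_apply, ProbabilityMeasure.coe_mk]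
    rw [Measure.map_apply (by fun_prop) measurableSet_Ioi]
    rfl
  · simp only [ProbabilityMeasure.coe_mk]
    rw [Measure.map_apply (by fun_prop) measurableSet_Ioi, one_sub_Phi]
    congr 2
    ext x
    simp [div_lt_iff₀ hβ]
    constructor <;> intro h <;> linarith

lemma continuous_Phi : Continuous Phi := by
  change Continuous (cdf (gaussianReal 0 1))
  refine continuous_iff_continuousAt.2 fun x => ?_
  rw [(monotone_cdf _).continuousAt_iff_leftLim_eq_rightLim, StieltjesFunction.rightLim_eq]
  have h := (cdf (gaussianReal 0 1)).measure_singleton x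
  rw [measure_cdf, measure_singleton] at h
  have h1 := ENNReal.ofReal_eq_zero.1 h.symm
  have h2 := (monotone_cdf (gaussianReal 0 1)).leftLim_le (le_refl x)
  linarith

lemma strictMono_Phi : StrictMono Phi := by
  intro x y hxy
  have hpos : (gaussianReal 0 1).IsOpenPosMeasure :=
    (gaussianReal_absolutelyContinuous' 0 one_ne_zero).isOpenPosMeasure
  have h : 0 < (gaussianReal 0 1).real (Set.Ioo x y) :=
    ENNReal.toReal_pos (isOpen_Ioo.measure_pos _ (Set.nonempty_Ioo.2 hxy)).ne' (measure_ne_top _ _)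
  have h2 : (gaussianReal 0 1).real (Set.Iic x ∪ Set.Ioo x y) ≤
      (gaussianReal 0 1).real (Set.Iic y) := by
    refine measureReal_mono ?_
    rintro z (hz | hz)
    · exact hz.trans hxy.le
    · exact hz.2.le
  have hdisj : Disjoint (Set.Iic x) (Set.Ioo x y) :=
    Set.disjoint_left.2 fun z hz hz' => hz'.1.not_ge hz
  rw [measureReal_union hdisj measurableSet_Ioo] at h2
  simp only [Phi, cdf_eq_real]
  linarith

lemma tendsto_Phi_atBot : Tendsto Phi atBot (𝓝 0) := tendsto_cdf_atBot _

lemma tendsto_Phi_atTop : Tendsto Phi atTop (𝓝 1) := tendsto_cdf_atTop _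

/-- The quantile function of the standard normal distribution. -/
def quantile (q : ℝ) : ℝ := Function.invFun Phi q

lemma Phi_quantile {q : ℝ} (h0 : 0 < q) (h1 : q < 1) : Phi (quantile q) = q :=
  Function.invFun_eq <| mem_range_of_exists_le_of_exists_ge continuous_Phi
    (tendsto_Phi_atBot.eventually_le_const h0).exists
    (tendsto_Phi_atTop.eventually_const_le h1).exists

/-- The limit of the accepted fraction of messages at the threshold `t`. -/
def acceptedLimit (δ ρ t : ℝ) : ℝ :=
  δ * (1 - Phi ((t - 1) / √ρ)) + (1 - δ) * (1 - Phi (t / √ρ))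

lemma acceptedLimit_def (δ ρ : ℝ) : acceptedLimit δ ρ =
    fun t => δ * (1 - Phi ((t - 1) / √ρ)) + (1 - δ) * (1 - Phi (t / √ρ)) := rfl

lemma existsUnique_acceptedLimit_eq {δ ρ : ℝ} (h0 : 0 < δ) (h1 : δ < 1) (hρ : 0 < ρ) :
    ∃! t, acceptedLimit δ ρ t = δ := by
  have hs : 0 < √ρ := Real.sqrt_pos.2 hρ
  have hanti : StrictAnti (acceptedLimit δ ρ) := by
    intro x y hxy
    have e1 := strictMono_Phi (show (x - 1) / √ρ < (y - 1) / √ρ by gcongr)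
    have e2 := strictMono_Phi (show x / √ρ < y / √ρ by gcongr)
    have e3 := mul_lt_mul_of_pos_left e1 h0
    have e4 := mul_lt_mul_of_pos_left e2 (sub_pos.2 h1)
    unfold acceptedLimit
    linarith
  have hcont : Continuous (acceptedLimit δ ρ) := by
    have := continuous_Phi
    unfold acceptedLimit
    fun_prop
  have ht : Tendsto (acceptedLimit δ ρ) atTop (𝓝 0) := by
    have e1 := tendsto_Phi_atTop.comp
      ((tendsto_atTop_add_const_right atTop (-1 : ℝ) tendsto_id).atTop_div_const hs)
    have e2 := tendsto_Phi_atTop.comp ((tendsto_id (α := ℝ)).atTop_div_const hs)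
    have := ((e1.const_sub 1).const_mul δ).add ((e2.const_sub 1).const_mul (1 - δ))
    simpa [acceptedLimit_def, Function.comp_def, sub_eq_add_neg] using this
  have hb : Tendsto (acceptedLimit δ ρ) atBot (𝓝 1) := by
    have e1 := tendsto_Phi_atBot.comp
      ((tendsto_atBot_add_const_right atBot (-1 : ℝ) tendsto_id).atBot_div_const hs)
    have e2 := tendsto_Phi_atBot.comp ((tendsto_id (α := ℝ)).atBot_div_const hs)
    have := ((e1.const_sub 1).const_mul δ).add ((e2.const_sub 1).const_mul (1 - δ))
    simpa [acceptedLimit_def, Function.comp_def, sub_eq_add_neg] using this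
  obtain ⟨t, h⟩ := mem_range_of_exists_le_of_exists_ge hcont
    (ht.eventually_le_const h0).exists (hb.eventually_const_le h1).exists
  exact ⟨t, h, fun u hu => hanti.injective (hu.trans h.symm)⟩

/-- The critical load of one step thresholding. -/
def criticalLoad (δ ε : ℝ) : ℝ :=
  ((quantile (1 - δ * ε / (1 - δ)) - quantile ε) ^ 2)⁻¹

lemma upper_level_mem {δ ε : ℝ} (hδ : 0 < δ) (hε : 0 < ε) (h : δ + ε < 1) :
    ε < 1 - δ * ε / (1 - δ) ∧ 1 - δ * ε / (1 - δ) < 1 := by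
  have h1 : 0 < 1 - δ := by linarith
  constructor
  · rw [lt_sub_comm, div_lt_iff₀ h1]
    nlinarith
  · have : 0 < δ * ε / (1 - δ) := by positivity
    linarith

lemma quantile_lt_quantile {δ ε : ℝ} (hδ : 0 < δ) (hε : 0 < ε) (h : δ + ε < 1) :
    quantile ε < quantile (1 - δ * ε / (1 - δ)) := by
  obtain ⟨h1, h2⟩ := upper_level_mem hδ hε h
  rw [← strictMono_Phi.lt_iff_lt, Phi_quantile hε (h1.trans h2), Phi_quantile (hε.trans h1) h2]
  exact h1

lemma criticalLoad_pos {δ ε : ℝ} (hδ : 0 < δ) (hε : 0 < ε) (h : δ + ε < 1) :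
    0 < criticalLoad δ ε :=
  inv_pos.2 (pow_pos (sub_pos.2 (quantile_lt_quantile hδ hε h)) 2)

lemma missed_cmp {δ ε ρ t : ℝ} (hδ : 0 < δ) (hε : 0 < ε) (h : δ + ε < 1) (hρ : 0 < ρ)
    (ht : acceptedLimit δ ρ t = δ) :
    (ρ < criticalLoad δ ε → Phi ((t - 1) / √ρ) < ε) ∧
    (ρ = criticalLoad δ ε → Phi ((t - 1) / √ρ) = ε) ∧
    (criticalLoad δ ε < ρ → ε < Phi ((t - 1) / √ρ)) := by
  obtain ⟨h1, h2⟩ := upper_level_mem hδ hε h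
  have hδ1 : 0 < 1 - δ := by linarith
  have hd := sub_pos.2 (quantile_lt_quantile hδ hε h)
  have ha := Phi_quantile hε (h1.trans h2)
  have hb := Phi_quantile (hε.trans h1) h2
  unfold criticalLoad
  set b := quantile (1 - δ * ε / (1 - δ))
  set a := quantile ε
  have hs : 0 < √ρ := Real.sqrt_pos.2 hρ
  set u := (t - 1) / √ρ with hu
  have htu : t / √ρ = u + 1 / √ρ := by rw [hu]; ring
  have hbal : δ * Phi u + (1 - δ) * Phi (u + 1 / √ρ) = δ * Phi a + (1 - δ) * Phi b := by
    rw [acceptedLimit, htu] at ht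
    rw [ha, hb]
    have : (1 - δ) * (1 - δ * ε / (1 - δ)) = 1 - δ - δ * ε := by field_simp
    linarith
  have hsq : √ρ ^ 2 = ρ := Real.sq_sqrt hρ.le
  have mono_le : ∀ {x y : ℝ}, x ≤ y → Phi x ≤ Phi y := fun hxy => strictMono_Phi.monotone hxy
  refine ⟨fun hlt => ?_, fun heq => ?_, fun hgt => ?_⟩
  · have hσ : b - a < 1 / √ρ := by
      rw [lt_div_iff₀ hs, ← sq_lt_sq₀ (by positivity) zero_le_one, mul_pow, hsq]
      rw [lt_inv_comm₀ hρ (by positivity), ← one_div, lt_div_iff₀ hρ] at hlt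
      linarith
    by_contra hc
    rw [← ha, not_lt, strictMono_Phi.le_iff_le] at hc
    have e1 := mul_le_mul_of_nonneg_left (mono_le hc) hδ.le
    have e2 := mul_lt_mul_of_pos_left (strictMono_Phi (show b < u + 1 / √ρ by linarith)) hδ1
    linarith
  · have hσ : b - a = 1 / √ρ := by
      rw [eq_div_iff hs.ne', ← sq_eq_sq₀ (by positivity) zero_le_one, mul_pow, hsq, heq]
      field_simp
    rw [← ha]
    rcases lt_trichotomy u a with hc | hc | hc
    · have e1 := mul_lt_mul_of_pos_left (strictMono_Phi hc) hδ
      have e2 := mul_lt_mul_of_pos_left (strictMono_Phi (show u + 1 / √ρ < b by linarith)) hδ1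
      linarith
    · rw [hc]
    · have e1 := mul_lt_mul_of_pos_left (strictMono_Phi hc) hδ
      have e2 := mul_lt_mul_of_pos_left (strictMono_Phi (show b < u + 1 / √ρ by linarith)) hδ1
      linarith
  · have hσ : 1 / √ρ < b - a := by
      rw [div_lt_iff₀ hs, ← sq_lt_sq₀ zero_le_one (by positivity), mul_pow, hsq]
      rw [inv_lt_comm₀ (by positivity) hρ, ← one_div, div_lt_iff₀ hρ] at hgt
      linarith
    by_contra hc
    rw [← ha, not_lt, strictMono_Phi.le_iff_le] at hc
    have e1 := mul_le_mul_of_nonneg_left (mono_le hc) hδ.le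
    have e2 := mul_lt_mul_of_pos_left (strictMono_Phi (show u + 1 / √ρ < b by linarith)) hδ1
    linarith

instance (n C : ℕ) (Q : ℝ≥0) : IsProbabilityMeasure (channelLaw n C Q) := by
  unfold channelLaw; infer_instance

lemma correlation_apply {n C : ℕ} (Λ : Finset (Fin C)) (ω : Outcome n C) (i : Fin C) :
    correlation Λ ω i = ∑ k, ω.1 k i * (∑ j ∈ Λ, ω.1 k j + ω.2 k) := by
  simp [correlation, received, codebook, noise, activity, Matrix.mulVec, dotProduct]

lemma measurable_correlation {n C : ℕ} (Λ : Finset (Fin C)) (i : Fin C) :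
    Measurable fun ω : Outcome n C => correlation Λ ω i := by
  simp only [correlation_apply]
  fun_prop

lemma card_filter_eq_sum_indicator {n C : ℕ} (Q : ℝ≥0) (Λ S : Finset (Fin C)) (t : ℝ)
    (ω : Outcome n C) :
    ((S.filter fun i => t < correlation Λ ω i / (n * Q)).card : ℝ) =
      ∑ i ∈ S, {ω : Outcome n C | t < correlation Λ ω i / (n * Q)}.indicator 1 ω := by
  simp [Set.indicator_apply]

lemma measurableSet_accepted {n C : ℕ} (Q : ℝ≥0) (Λ : Finset (Fin C)) (t : ℝ) (i : Fin C) :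
    MeasurableSet {ω : Outcome n C | t < correlation Λ ω i / (n * Q)} :=
  measurableSet_lt measurable_const ((measurable_correlation Λ i).div_const _)

lemma integrable_indicator_accepted {n C : ℕ} (Q : ℝ≥0) (Λ : Finset (Fin C)) (t : ℝ)
    (i : Fin C) :
    Integrable ({ω : Outcome n C | t < correlation Λ ω i / (n * Q)}.indicator (1 : Outcome n C → ℝ))
      (channelLaw n C Q) :=
  (integrable_const (1 : ℝ)).indicator (measurableSet_accepted Q Λ t i)

lemma integrable_card_filter_div {n C : ℕ} (Q : ℝ≥0) (Λ S : Finset (Fin C)) (t : ℝ) :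
    Integrable (fun ω : Outcome n C =>
      ((S.filter fun i => t < correlation Λ ω i / (n * Q)).card : ℝ) / C)
      (channelLaw n C Q) := by
  simp only [card_filter_eq_sum_indicator]
  exact (integrable_finsetSum _ fun i _ => integrable_indicator_accepted Q Λ t i).div_const _

lemma integral_card_filter_div {n C : ℕ} (Q : ℝ≥0) (Λ S : Finset (Fin C)) (t p : ℝ)
    (hp : ∀ i ∈ S, (channelLaw n C Q).real {ω | t < correlation Λ ω i / (n * Q)} = p) :
    ∫ ω, ((S.filter fun i => t < correlation Λ ω i / (n * Q)).card : ℝ) / C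
      ∂(channelLaw n C Q) = S.card / C * p := by
  simp only [card_filter_eq_sum_indicator]
  rw [integral_div, integral_finsetSum _ fun i _ => integrable_indicator_accepted Q Λ t i,
    Finset.sum_congr rfl fun i hi => (integral_indicator_one
      (measurableSet_accepted Q Λ t i)).trans (hp i hi)]
  simp
  ring

lemma channelLaw_real_accepted_of_mem (n : ℕ) {C : ℕ} {Q : ℝ≥0} (hQ : 0 < Q)
    {Λ : Finset (Fin C)} {i : Fin C} (hi : i ∈ Λ) (t : ℝ) :
    (channelLaw n C Q).real {ω | t < correlation Λ ω i / (n * Q)} =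
      pairSeq.real {w | t < pairStat 1 √(((Λ.card - 1 : ℕ) + 1 / (Q : ℝ)) / n) n w} := by
  rw [← Finset.card_erase_of_mem hi,
    ← channelLaw_real_lt_eq n hQ (Λ.erase i) (Finset.notMem_erase i Λ)]
  simp only [correlation_apply, ← Finset.add_sum_erase Λ _ hi, one_mul, add_assoc]

lemma channelLaw_real_accepted_of_notMem (n : ℕ) {C : ℕ} {Q : ℝ≥0} (hQ : 0 < Q)
    {Λ : Finset (Fin C)} {i : Fin C} (hi : i ∉ Λ) (t : ℝ) :
    (channelLaw n C Q).real {ω | t < correlation Λ ω i / (n * Q)} =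
      pairSeq.real {w | t < pairStat 0 √((Λ.card + 1 / (Q : ℝ)) / n) n w} := by
  rw [← channelLaw_real_lt_eq n hQ Λ hi]
  simp only [correlation_apply, zero_mul, zero_add]

variable {n C : ℕ → ℕ} {Q : ℕ → ℝ≥0} {Λ : ∀ r, Finset (Fin (C r))} {δ ρ : ℝ}

lemma IsRegime.tendsto_load_pred (h : IsRegime n C Q Λ δ ρ) :
    Tendsto (fun r => ((((Λ r).card - 1 : ℕ) : ℝ) + 1 / (Q r : ℝ)) / n r) atTop (𝓝 ρ) := by
  have hinv : Tendsto (fun r => 1 / (n r : ℝ)) atTop (𝓝 0) :=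
    tendsto_one_div_atTop_nhds_zero_nat.comp h.length_tendsto
  have hsub := h.load_tendsto.sub hinv
  rw [sub_zero] at hsub
  refine tendsto_of_tendsto_of_tendsto_of_le_of_le hsub
    h.load_tendsto (fun r => ?_) (fun r => ?_)
  · have : ((Λ r).card : ℝ) ≤ ((Λ r).card - 1 : ℕ) + 1 := by
      exact_mod_cast Nat.le_succ_of_pred_le le_rfl
    simp only [← sub_div]
    gcongr
    linarith
  · have : (((Λ r).card - 1 : ℕ) : ℝ) ≤ (Λ r).card := by exact_mod_cast Nat.sub_le _ _
    simp only
    gcongr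

lemma IsRegime.tendsto_integral_fracTransmitted (h : IsRegime n C Q Λ δ ρ) (hρ : 0 < ρ) (t : ℝ) :
    Tendsto (fun r => ∫ ω, fracTransmitted (Q r) (Λ r) t ω ∂(channelLaw (n r) (C r) (Q r)))
      atTop (𝓝 (δ * (1 - Phi ((t - 1) / √ρ)))) := by
  refine (h.density_tendsto.mul (tendsto_pairSeq_real_lt_pairStat h.length_tendsto
    (Real.sqrt_pos.2 hρ) h.tendsto_load_pred.sqrt 1 t)).congr fun r => ?_
  exact (integral_card_filter_div _ _ _ _ _ fun i hi =>
    channelLaw_real_accepted_of_mem (n r) (h.power_pos r) hi t).symm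

lemma IsRegime.tendsto_integral_fracNontransmitted (h : IsRegime n C Q Λ δ ρ) (hρ : 0 < ρ)
    (t : ℝ) :
    Tendsto (fun r => ∫ ω, fracNontransmitted (Q r) (Λ r) t ω ∂(channelLaw (n r) (C r) (Q r)))
      atTop (𝓝 ((1 - δ) * (1 - Phi (t / √ρ)))) := by
  have hlim := (h.density_tendsto.const_sub 1).mul (tendsto_pairSeq_real_lt_pairStat
    h.length_tendsto (Real.sqrt_pos.2 hρ) h.load_tendsto.sqrt 0 t)
  rw [sub_zero] at hlim
  refine hlim.congr fun r => ?_
  have hC : (C r : ℝ) ≠ 0 := by exact_mod_cast (h.messages_pos r).ne'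
  have hcard : (((Λ r)ᶜ.card : ℕ) : ℝ) / C r = 1 - (Λ r).card / C r := by
    rw [Finset.card_compl, Nat.cast_sub (Finset.card_le_univ _), Fintype.card_fin, sub_div,
      div_self hC]
  rw [← hcard]
  exact (integral_card_filter_div _ _ _ _ _ fun i hi =>
    channelLaw_real_accepted_of_notMem (n r) (h.power_pos r) (Finset.mem_compl.1 hi) t).symm

lemma IsRegime.tendsto_integral_accepted (h : IsRegime n C Q Λ δ ρ) (hρ : 0 < ρ) (t : ℝ) :
    Tendsto (fun r => ∫ ω, (fracTransmitted (Q r) (Λ r) t ω + fracNontransmitted (Q r) (Λ r) t ω)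
      ∂(channelLaw (n r) (C r) (Q r))) atTop (𝓝 (acceptedLimit δ ρ t)) := by
  refine ((h.tendsto_integral_fracTransmitted hρ t).add
    (h.tendsto_integral_fracNontransmitted hρ t)).congr fun r => ?_
  exact (integral_add (integrable_card_filter_div _ _ _ _)
    (integrable_card_filter_div _ _ _ _)).symm

lemma IsRegime.tendsto_integral_accepted_iff (h : IsRegime n C Q Λ δ ρ) (hρ : 0 < ρ) (t : ℝ) :
    Tendsto (fun r => ∫ ω, (fracTransmitted (Q r) (Λ r) t ω + fracNontransmitted (Q r) (Λ r) t ω)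
      ∂(channelLaw (n r) (C r) (Q r))) atTop (𝓝 δ) ↔ acceptedLimit δ ρ t = δ :=
  ⟨fun h' => tendsto_nhds_unique (h.tendsto_integral_accepted hρ t) h',
    fun h' => by simpa only [h'] using h.tendsto_integral_accepted hρ t⟩

end

end OST

theorem corollary1 :
    -- the limits of `E P_t` and `E Q_t`
    (∀ (n C : ℕ → ℕ) (Q : ℕ → ℝ≥0) (Λ : ∀ r, Finset (Fin (C r))) (δ ρ : ℝ),
      0 < ρ → OST.IsRegime n C Q Λ δ ρ → ∀ t : ℝ,
        Tendsto (fun r => ∫ ω, OST.fracTransmitted (Q r) (Λ r) t ω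
            ∂(OST.channelLaw (n r) (C r) (Q r)))
          atTop (𝓝 (δ * (1 - OST.Phi ((t - 1) / √ρ)))) ∧
        Tendsto (fun r => ∫ ω, OST.fracNontransmitted (Q r) (Λ r) t ω
            ∂(OST.channelLaw (n r) (C r) (Q r)))
          atTop (𝓝 ((1 - δ) * (1 - OST.Phi (t / √ρ))))) ∧
    -- the phase transition
    (∃ c : ℝ → ℝ → ℝ, ∀ δ ε : ℝ, 0 < δ → 0 < ε → δ + ε < 1 →
      0 < c δ ε ∧
      ∀ (n C : ℕ → ℕ) (Q : ℕ → ℝ≥0) (Λ : ∀ r, Finset (Fin (C r))) (ρ : ℝ),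
        0 < ρ → OST.IsRegime n C Q Λ δ ρ →
        -- `E P_t = (1 - ε) δ` and `E (P_t + Q_t) = δ` can be solved, asymptotically, exactly when
        -- `(K + 1 / Q) / n = c(δ, ε)` asymptotically
        ((∃ t : ℝ,
            Tendsto (fun r => ∫ ω, OST.fracTransmitted (Q r) (Λ r) t ω
                ∂(OST.channelLaw (n r) (C r) (Q r)))
              atTop (𝓝 ((1 - ε) * δ)) ∧
            Tendsto (fun r => ∫ ω, (OST.fracTransmitted (Q r) (Λ r) t ω
                + OST.fracNontransmitted (Q r) (Λ r) t ω) ∂(OST.channelLaw (n r) (C r) (Q r)))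
              atTop (𝓝 δ)) ↔
          Tendsto (fun r => (((Λ r).card : ℝ) + 1 / (Q r : ℝ)) / n r) atTop (𝓝 (c δ ε))) ∧
        -- at the unique threshold for which the accepted fraction is `δ`, the limiting fraction `p`
        -- of transmitted messages that are missed is below, at or above `ε` according as
        -- `ρ` is below, at or above `c(δ, ε)`
        (∃! t : ℝ,
            Tendsto (fun r => ∫ ω, (OST.fracTransmitted (Q r) (Λ r) t ω
                + OST.fracNontransmitted (Q r) (Λ r) t ω) ∂(OST.channelLaw (n r) (C r) (Q r)))
              atTop (𝓝 δ)) ∧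
        (∀ t : ℝ,
            Tendsto (fun r => ∫ ω, (OST.fracTransmitted (Q r) (Λ r) t ω
                + OST.fracNontransmitted (Q r) (Λ r) t ω) ∂(OST.channelLaw (n r) (C r) (Q r)))
              atTop (𝓝 δ) →
          ∃ p : ℝ,
            Tendsto (fun r => ∫ ω, OST.fracTransmitted (Q r) (Λ r) t ω
                ∂(OST.channelLaw (n r) (C r) (Q r)))
              atTop (𝓝 ((1 - p) * δ)) ∧
            (p < ε ↔ ρ < c δ ε) ∧ (p = ε ↔ ρ = c δ ε) ∧ (ε < p ↔ c δ ε < ρ))) := by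
  refine ⟨fun n C Q Λ δ ρ hρ h t => ⟨h.tendsto_integral_fracTransmitted hρ t,
    h.tendsto_integral_fracNontransmitted hρ t⟩, OST.criticalLoad, fun δ ε hδ hε hδε =>
    ⟨OST.criticalLoad_pos hδ hε hδε, fun n C Q Λ ρ hρ h => ?_⟩⟩
  simp only [h.tendsto_integral_accepted_iff hρ]
  have huniq := OST.existsUnique_acceptedLimit_eq hδ (by linarith) hρ
  refine ⟨⟨?_, fun hc => ?_⟩, huniq, fun t ht => ?_⟩
  · rintro ⟨t, hP, ht⟩
    have hp := tendsto_nhds_unique (h.tendsto_integral_fracTransmitted hρ t) hP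
    have hp' : OST.Phi ((t - 1) / √ρ) = ε := by
      rw [mul_comm δ] at hp
      linarith [mul_right_cancel₀ hδ.ne' hp]
    obtain ⟨h1, -, h3⟩ := OST.missed_cmp hδ hε hδε hρ ht
    have hρc : ρ = OST.criticalLoad δ ε :=
      le_antisymm (not_lt.1 fun hlt => (h3 hlt).ne' hp') (not_lt.1 fun hlt => (h1 hlt).ne hp')
    exact hρc ▸ h.load_tendsto
  · obtain ⟨t, ht, -⟩ := huniq
    refine ⟨t, ?_, ht⟩
    have hp := (OST.missed_cmp hδ hε hδε hρ ht).2.1 (tendsto_nhds_unique h.load_tendsto hc)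
    rw [mul_comm, ← hp]
    exact h.tendsto_integral_fracTransmitted hρ t
  · obtain ⟨h1, h2, h3⟩ := OST.missed_cmp hδ hε hδε hρ ht
    refine ⟨OST.Phi ((t - 1) / √ρ), ?_, ?_⟩
    · rw [mul_comm]
      exact h.tendsto_integral_fracTransmitted hρ t
    · rcases lt_trichotomy ρ (OST.criticalLoad δ ε) with hlt | heq | hgt
      · have := h1 hlt
        simp [hlt, hlt.ne, hlt.not_gt, this, this.ne, this.not_gt]
      · have := h2 heq
        simp [this, ← heq]
      · have := h3 hgt
        simp [hgt, hgt.ne', hgt.not_gt, this, this.ne', this.not_gt]
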